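/- Let $n$ be a natural number, let $\mathbb F$ be a field with $\operatorname{char}\mathbb F\neq 2$ and $|\mathbb F|\ge n^2+1$ (possibly infinite), let $M_n$ be the set of all $n\times n$ matrices over $\mathbb F$, and let $\Sigma_n\subseteq M_n$ be the set of all symmetric matrices. Let $\phi,\psi:\Sigma_n\to\Sigma_n$ be arbitrary maps (not assumed linear), at least one of which is surjective, such that $$\det(\phi(x)+\psi(y))=\det(x+y)\qquad\text{for all }x,y\in\Sigma_n.$$ Then there exist $x_0\in\Sigma_n$, $u\in M_n$ and $\beta\in\mathbb F$ with $\det(\beta u^2)=1$ such that, for all $x\in\Sigma_n$, $$\phi(x)=\beta\,u(x+x_0)u^t\qquad\text{and}\qquad\psi(x)=\beta\,u(x-x_0)u^t,$$ where $u^t$ denotes the transpose of $u$. -/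

import Mathlib

/-- The space `Σ_n(F)` of symmetric `n × n` matrices over `F`, as a subspace of `M_n(F)`. -/
def symMat (n : ℕ) (F : Type*) [Field F] : Submodule F (Matrix (Fin n) (Fin n) F) where
  carrier := {x | x.IsSymm}
  add_mem' := fun hx hy => hx.add hy
  zero_mem' := Matrix.isSymm_zero
  smul_mem' := fun c _ hx => hx.smul c

/-! Say `ψ` is surjective. Along `x + t v vᵗ` every `det (φ + z)`, `z` symmetric, is affine in `t`.
Varying `z` extracts the entries and 2×2 principal minors of `φ`, also after congruence, so `φ`
moves along a line of direction of rank at most one (`exists_isSymmRankOne_direction`). Injectivity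
makes this direction independent of the base point (`sub_add_eq_of_lines`), so `φ` is affine with
linear part `L`. Then `ψ` has the same linear part, and homogeneity of `det` forces opposite
translations (`exists_linear_translate`). Finally `L` preserves `det` and sends squares `v vᵗ` to
rank at most one; after a congruence it acts entrywise, and its value on the all-ones matrix
displays it as a scaled congruence (`exists_congr_of_diagonal`). -/

open Matrix

section RankOne

variable {ι F : Type*} [Field F]

/-- The symmetric matrix `B` has rank at most one. -/
def IsSymmRankOne (B : Matrix ι ι F) : Prop := ∃ (c : F) (f : ι → F), B = c • vecMulVec f f

lemma IsSymmRankOne.minor_eq {B : Matrix ι ι F} (h : IsSymmRankOne B) (i j k l : ι) :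
    B i j * B k l = B i l * B k j := by
  obtain ⟨c, f, rfl⟩ := h
  simp [vecMulVec_apply]; ring

lemma IsSymmRankOne.isSymm {B : Matrix ι ι F} (h : IsSymmRankOne B) : B.IsSymm := by
  obtain ⟨c, f, rfl⟩ := h
  simp [Matrix.IsSymm, transpose_vecMulVec]

end RankOne

/-! ### Principal minors recovered from determinants of translates -/

section Minors

variable {ι X F : Type*} [Fintype ι] [DecidableEq ι] [Field F]

/-- The matrix `y` with the rows outside `K` replaced by those of the identity; its determinant is
the principal minor of `y` on `K`. -/
def keepRows (K : Finset ι) (y : Matrix ι ι F) : Matrix ι ι F :=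
  of fun i => if i ∈ K then y i else (1 : Matrix ι ι F) i

lemma keepRows_univ (y : Matrix ι ι F) : keepRows Finset.univ y = y := by
  ext i j; simp [keepRows]

lemma det_keepRows_erase {K : Finset ι} {j : ι} (hj : j ∈ K) (y : Matrix ι ι F) :
    (keepRows (K.erase j) y).det =
      (keepRows K (y + Matrix.single j j 1)).det - (keepRows K y).det := by
  have h1 : keepRows K (y + Matrix.single j j 1) =
      (keepRows K y).updateRow j (y j + (1 : Matrix ι ι F) j) := by
    ext k l
    by_cases hk : k = j
    · subst hk; simp [keepRows, hj, Matrix.single_apply, Matrix.one_apply]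
    · have : (y + Matrix.single j j 1 : Matrix ι ι F) k = y k := by
        ext l; simp [Ne.symm hk]
      rw [updateRow_ne hk]
      simp only [keepRows, of_apply, this]
  have h2 : keepRows K y = (keepRows K y).updateRow j (y j) := by
    ext k l
    by_cases hk : k = j
    · subst hk; simp [keepRows, hj]
    · simp [hk]
  have h3 : keepRows (K.erase j) y = (keepRows K y).updateRow j ((1 : Matrix ι ι F) j) := by
    ext k l
    by_cases hk : k = j
    · subst hk; simp [keepRows]
    · simp [keepRows, hk]
  rw [h1, h3, det_updateRow_add, ← h2]; ring

lemma det_keepRows_singleton (y : Matrix ι ι F) (i : ι) : (keepRows {i} y).det = y i i := by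
  have h : keepRows {i} y = (1 : Matrix ι ι F).updateRow i (y i) := by
    ext k l
    by_cases hk : k = i
    · subst hk; simp [keepRows]
    · simp [keepRows, hk]
  rw [h, ← cramer_transpose_apply]; simp

lemma det_keepRows_pair (y : Matrix ι ι F) {i j : ι} (hij : i ≠ j) :
    (keepRows {i, j} y).det = y i i * y j j - y i j * y j i := by
  let U : Matrix ι (Fin 2) F := of fun k => ![if k = i then 1 else 0, if k = j then 1 else 0]
  let V : Matrix (Fin 2) ι F := of ![y i - (1 : Matrix ι ι F) i, y j - (1 : Matrix ι ι F) j]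
  have h : keepRows {i, j} y = 1 + U * V := by
    ext k l
    by_cases hk : k = i
    · subst hk; simp [keepRows, U, V, Matrix.mul_apply, Fin.sum_univ_two, hij]
    · by_cases hk' : k = j
      · subst hk'; simp [keepRows, U, V, Matrix.mul_apply, Fin.sum_univ_two, hk]
      · simp [keepRows, U, V, Matrix.mul_apply, Fin.sum_univ_two, hk, hk']
  rw [h, det_one_add_mul_comm, det_fin_two]
  simp [U, V, vecMul, dotProduct, hij, hij.symm]

variable {S : Submodule F (X → F)} {γ : X → Matrix ι ι F}

/-- Rows are removed one at a time: replacing `z` by `z + E j j` and subtracting leaves the minor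
without row `j`. A general `S` serves both affine functions and equality of two values. -/
lemma det_keepRows_mem (hγ : ∀ z : Matrix ι ι F, z.IsSymm → (fun t => (γ t + z).det) ∈ S)
    (K : Finset ι) :
    ∀ z : Matrix ι ι F, z.IsSymm → (fun t => (keepRows K (γ t + z)).det) ∈ S := by
  suffices h : ∀ T : Finset ι, ∀ z : Matrix ι ι F, z.IsSymm →
      (fun t => (keepRows Tᶜ (γ t + z)).det) ∈ S by
    simpa using h Kᶜ
  intro T
  induction T using Finset.induction_on with
  | empty => simpa [keepRows_univ] using hγ
  | insert j T hj ih =>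
    intro z hz
    have hs : (Matrix.single j j (1 : F)).IsSymm := by
      simp [Matrix.IsSymm]
    have := S.sub_mem (ih _ (hz.add hs)) (ih z hz)
    convert this using 2 with t
    rw [Finset.compl_insert, det_keepRows_erase (by simpa using hj)]
    simp [add_assoc]

lemma diag_mem (hγ : ∀ z : Matrix ι ι F, z.IsSymm → (fun t => (γ t + z).det) ∈ S) (i : ι) :
    (fun t => γ t i i) ∈ S := by
  simpa [det_keepRows_singleton] using det_keepRows_mem hγ {i} 0 (by simp)

lemma minor_mem (hγ : ∀ z : Matrix ι ι F, z.IsSymm → (fun t => (γ t + z).det) ∈ S)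
    {i j : ι} (hij : i ≠ j) : (fun t => γ t i i * γ t j j - γ t i j * γ t j i) ∈ S := by
  simpa [det_keepRows_pair _ hij] using det_keepRows_mem hγ {i, j} 0 (by simp)

lemma entry_mem (h2 : (2 : F) ≠ 0) (hS : (fun _ => (1 : F)) ∈ S) (hsymm : ∀ t, (γ t).IsSymm)
    (hγ : ∀ z : Matrix ι ι F, z.IsSymm → (fun t => (γ t + z).det) ∈ S) (i j : ι) :
    (fun t => γ t i j) ∈ S := by
  by_cases hij : i = j
  · subst hij; exact diag_mem hγ i
  have hs : (Matrix.single i j (1 : F) + Matrix.single j i 1).IsSymm := by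
    simp [Matrix.IsSymm, add_comm]
  have h := det_keepRows_mem hγ {i, j} _ hs
  simp only [det_keepRows_pair _ hij] at h
  -- Raising the off-diagonal entry by 1 changes the minor by `-2 γ i j - 1`.
  have := S.smul_mem (-(1 / 2) : F) (S.add_mem (S.sub_mem h (minor_mem hγ hij)) hS)
  convert this using 2 with t
  have hji : γ t j i = γ t i j := (hsymm t).apply i j
  simp [hij, Ne.symm hij, hji]
  field_simp
  ring

lemma congr_mem (hγ : ∀ z : Matrix ι ι F, z.IsSymm → (fun t => (γ t + z).det) ∈ S)
    {Q : Matrix ι ι F} (hQ : Q.det = 1) :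
    ∀ z : Matrix ι ι F, z.IsSymm → (fun t => (Q * γ t * Qᵀ + z).det) ∈ S := by
  intro z hz
  have hu : IsUnit Q.det := by simp [hQ]
  have hu' : IsUnit Qᵀ.det := by simp [hQ]
  have := hγ (Q⁻¹ * z * Q⁻¹ᵀ) (by simp [Matrix.IsSymm, hz.eq, Matrix.mul_assoc])
  convert this using 2 with t
  have : Q * γ t * Qᵀ + z = Q * (γ t + Q⁻¹ * z * Q⁻¹ᵀ) * Qᵀ := by
    rw [Matrix.mul_add, Matrix.add_mul, Matrix.transpose_nonsing_inv]
    congr 1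
    simp only [Matrix.mul_assoc, Matrix.nonsing_inv_mul _ hu', Matrix.mul_one]
    rw [← Matrix.mul_assoc, Matrix.mul_nonsing_inv _ hu, Matrix.one_mul]
  rw [this]; simp [hQ]

lemma IsSymmRankOne.congr {B : Matrix ι ι F} (h : IsSymmRankOne B) (Q : Matrix ι ι F) :
    IsSymmRankOne (Q * B * Qᵀ) := by
  obtain ⟨c, f, rfl⟩ := h
  exact ⟨c, Q *ᵥ f, by simp [mul_vecMulVec, vecMulVec_mul, vecMul_transpose]⟩

lemma IsSymmRankOne.of_principal_minors (h2 : (2 : F) ≠ 0) {B : Matrix ι ι F} (hB : B.IsSymm)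
    (h : ∀ Q : Matrix ι ι F, Q.det = 1 → ∀ i j, i ≠ j →
      (Q * B * Qᵀ) i i * (Q * B * Qᵀ) j j = (Q * B * Qᵀ) i j * (Q * B * Qᵀ) i j) :
    IsSymmRankOne B := by
  have h1 : ∀ i j, B i i * B j j = B i j * B i j := by
    intro i j
    by_cases hij : i = j
    · rw [hij]
    · simpa using h 1 (by simp) i j hij
  have h3 : ∀ p i j, B p p * B i j = B p i * B p j := by
    intro p i j
    by_cases hij : i = j
    · subst hij; exact h1 _ _
    by_cases hpi : p = i
    · subst hpi; rfl
    by_cases hpj : p = j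
    · subst hpj; rw [hB.apply p i, mul_comm]
    -- Adding row and column `j` to `i` polarizes the identity on principal minors.
    set Q : Matrix ι ι F := transvection i j 1 with hQ
    have := h Q (det_transvection_of_ne _ _ hij 1) p i hpi
    have e1 : (Q * B * Qᵀ) p p = B p p := by
      simp [hQ, transvection, Matrix.add_mul, Matrix.mul_add, hpi, Ne.symm hpi]
    have e2 : (Q * B * Qᵀ) p i = B p i + B p j := by
      simp [hQ, transvection, Matrix.add_mul, Matrix.mul_add, hpi, Ne.symm hpi]
    have e3 : (Q * B * Qᵀ) i i =
        B i i + B j i + (B i j + B j j) := by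
      simp [hQ, transvection, Matrix.add_mul, Matrix.mul_add, Matrix.mul_assoc]
    rw [e1, e2, e3, hB.apply i j] at this
    apply mul_left_cancel₀ h2
    linear_combination this - h1 p i - h1 p j
  by_cases h0 : ∃ p, B p p ≠ 0
  · obtain ⟨p, hp⟩ := h0
    refine ⟨(B p p)⁻¹, B p, ?_⟩
    ext i j
    simp [vecMulVec_apply, ← h3]
    field_simp
  · push Not at h0
    refine ⟨0, 0, ?_⟩
    ext i j
    have := h1 i j
    simp [h0] at this
    simp [this]

end Minors

/-! ### Lines of rank-one direction -/

section RankOneLines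

variable {ι F : Type*} [Field F]

/-- Adding the minor identities of `B + E` and `B - E` gives those of `E`; the mixed terms then make
the rows of `B` and `E` proportional. -/
lemma exists_eq_smul_of_isSymmRankOne_add (h2 : (2 : F) ≠ 0) {B E : Matrix ι ι F}
    (hB : IsSymmRankOne B) (hadd : IsSymmRankOne (B + E)) (hsub : IsSymmRankOne (B - E))
    (hE : E ≠ 0) : ∃ b : F, B = b • E := by
  have hBs := hB.isSymm.apply
  have hEs : ∀ i j, E j i = E i j := by
    intro i j
    have := hadd.isSymm.apply i j
    simpa [hBs i j] using this
  have mB : ∀ p i j, B p p * B i j = B p i * B p j := by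
    intro p i j
    have := hB.minor_eq p p i j
    rw [hBs p i] at this; rw [this, mul_comm]
  have m1 : ∀ p i j, (B p p + E p p) * (B i j + E i j) = (B p i + E p i) * (B p j + E p j) := by
    intro p i j
    have := hadd.minor_eq p p i j
    simp only [Matrix.add_apply] at this
    rw [hBs p i, hEs p i] at this; rw [this, mul_comm]
  have m2 : ∀ p i j, (B p p - E p p) * (B i j - E i j) = (B p i - E p i) * (B p j - E p j) := by
    intro p i j
    have := hsub.minor_eq p p i j
    simp only [Matrix.sub_apply] at this
    rw [hBs p i, hEs p i] at this; rw [this, mul_comm]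
  have mE : ∀ p i j, E p p * E i j = E p i * E p j := by
    intro p i j
    apply mul_left_cancel₀ h2
    linear_combination m1 p i j + m2 p i j - 2 * mB p i j
  have mix : ∀ p i j, B p p * E i j + E p p * B i j = B p i * E p j + E p i * B p j := by
    intro p i j
    linear_combination m1 p i j - mB p i j - mE p i j
  obtain ⟨p, hp⟩ : ∃ p, E p p ≠ 0 := by
    by_contra! h0
    refine hE (Matrix.ext fun i j => ?_)
    have := mE i j j
    simp only [h0, zero_mul] at this
    simpa using this.symm
  have hrow : ∀ i, E p p * B p i = E p i * B p p := by
    intro i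
    have : (E p p * B p i - E p i * B p p) ^ 2 = 0 := by
      linear_combination E p p * B p p * mix p i i - E p p ^ 2 * mB p i i - B p p ^ 2 * mE p i i
    exact sub_eq_zero.1 (pow_eq_zero_iff two_ne_zero |>.1 this)
  refine ⟨B p p / E p p, Matrix.ext fun i j => ?_⟩
  rw [Matrix.smul_apply, smul_eq_mul, div_mul_eq_mul_div, eq_div_iff hp]
  apply mul_left_cancel₀ hp
  linear_combination E p p * mix p i j + E p j * hrow i + E p i * hrow j - 2 * B p p * mE p i j

/-- The functions `F → F` of the form `t ↦ a + t * b`. -/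
def affineFunctions (F : Type*) [Field F] : Submodule F (F → F) where
  carrier := {f | ∃ a b, ∀ t, f t = a + t * b}
  add_mem' := by
    rintro f g ⟨a, b, hf⟩ ⟨c, d, hg⟩
    exact ⟨a + c, b + d, fun t => by simp [hf, hg]; ring⟩
  zero_mem' := ⟨0, 0, by simp⟩
  smul_mem' := by
    rintro r f ⟨a, b, hf⟩
    exact ⟨r * a, r * b, fun t => by simp [hf]; ring⟩

lemma eq_of_mem_affineFunctions {f : F → F} (hf : f ∈ affineFunctions F) (t : F) :
    f t = f 0 + t * (f 1 - f 0) := by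
  obtain ⟨a, b, h⟩ := hf
  simp [h]

variable [Fintype ι] [DecidableEq ι]

lemma det_add_smul_vecMulVec_mem (A : Matrix ι ι F) (u v : ι → F) :
    (fun t : F => (A + t • vecMulVec u v).det) ∈ affineFunctions F := by
  -- By the Schur complement, a bordered matrix confines `t` to one row.
  let N : F → Matrix (ι ⊕ Unit) (ι ⊕ Unit) F := fun t =>
    fromBlocks A (-replicateCol Unit u) (t • replicateRow Unit v) 1
  have h1 : ∀ t, (A + t • vecMulVec u v).det = (N t).det := by
    intro t
    rw [det_fromBlocks_one₂₂, vecMulVec_eq Unit]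
    simp
  have h2 : ∀ t, N t = (N 0).updateRow (Sum.inr ())
      (t • Sum.elim v (0 : Unit → F) + Sum.elim (0 : ι → F) (1 : Unit → F)) := by
    intro t
    ext i j
    rcases i with i | i <;> rcases j with j | j <;> simp [N, updateRow_apply, fromBlocks]
  refine ⟨((N 0).updateRow (Sum.inr ()) (Sum.elim (0 : ι → F) (1 : Unit → F))).det,
    ((N 0).updateRow (Sum.inr ()) (Sum.elim v (0 : Unit → F))).det, fun t => ?_⟩
  beta_reduce
  rw [h1, h2, det_updateRow_add, det_updateRow_smul, add_comm]

lemma exists_isSymmRankOne_direction (h2 : (2 : F) ≠ 0) {γ : F → Matrix ι ι F}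
    (hsymm : ∀ t, (γ t).IsSymm)
    (hγ : ∀ z : Matrix ι ι F, z.IsSymm → (fun t => (γ t + z).det) ∈ affineFunctions F) :
    ∃ B : Matrix ι ι F, IsSymmRankOne B ∧ ∀ t, γ t = γ 0 + t • B := by
  have hlin : ∀ t, γ t = γ 0 + t • (γ 1 - γ 0) := by
    intro t
    ext i j
    exact eq_of_mem_affineFunctions (entry_mem h2 (show (fun _ => (1 : F)) ∈ affineFunctions F from ⟨1, 0, by simp⟩) hsymm hγ i j) t
  refine ⟨γ 1 - γ 0, ?_, hlin⟩
  have hBs : (γ 1 - γ 0).IsSymm := (hsymm 1).sub (hsymm 0)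
  refine IsSymmRankOne.of_principal_minors h2 hBs fun Q hQ i j hij => ?_
  -- The second difference at -1, 0, 1 is twice the minor of the direction.
  have h := eq_of_mem_affineFunctions (minor_mem (congr_mem hγ hQ) hij) (-1)
  have hQlin : ∀ t, Q * γ t * Qᵀ = Q * γ 0 * Qᵀ + t • (Q * (γ 1 - γ 0) * Qᵀ) := by
    intro t
    conv_lhs => rw [hlin t]
    simp [Matrix.mul_add, Matrix.add_mul]
  have hs : (Q * (γ 1 - γ 0) * Qᵀ) j i = (Q * (γ 1 - γ 0) * Qᵀ) i j := by
    have : (Q * (γ 1 - γ 0) * Qᵀ).IsSymm := by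
      rw [Matrix.IsSymm, transpose_mul, transpose_mul, transpose_transpose, hBs.eq,
        Matrix.mul_assoc]
    exact this.apply i j
  rw [hQlin (-1), hQlin 1] at h
  generalize Q * (γ 1 - γ 0) * Qᵀ = B at *
  generalize Q * γ 0 * Qᵀ = A at *
  simp only [Matrix.add_apply, Matrix.smul_apply, smul_eq_mul, hs] at h
  apply mul_left_cancel₀ h2
  linear_combination h

end RankOneLines

/-! ### Squares span the symmetric matrices -/

section Span

variable {n : ℕ} {F : Type*} [Field F]

/-- The symmetric matrix `v vᵗ`. -/
def sqMat (v : Fin n → F) : symMat n F := ⟨vecMulVec v v, transpose_vecMulVec v v⟩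

/-- The symmetric matrix `E i j + E j i`. -/
def symPair (i j : Fin n) : symMat n F :=
  sqMat (Pi.single i 1 + Pi.single j 1) - sqMat (Pi.single i 1) - sqMat (Pi.single j 1)

lemma coe_symPair (i j : Fin n) : ((symPair i j : symMat n F) : Matrix (Fin n) (Fin n) F) =
    Matrix.single i j 1 + Matrix.single j i 1 := by
  simp only [symPair, sqMat, AddSubgroupClass.coe_sub, vecMulVec_add, add_vecMulVec]
  simp only [← Matrix.single_eq_single_vecMulVec_single]
  abel

lemma symMat_eq_sum (h2 : (2 : F) ≠ 0) (x : symMat n F) :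
    x = ∑ i, ∑ j, ((x : Matrix (Fin n) (Fin n) F) i j / 2) • symPair i j := by
  ext k l
  have hs : (x : Matrix (Fin n) (Fin n) F) l k = (x : Matrix (Fin n) (Fin n) F) k l :=
    Matrix.IsSymm.apply x.2 k l
  simp [coe_symPair, Matrix.sum_apply, Matrix.single_apply, Finset.sum_add_distrib,
    ite_and, hs]
  field_simp
  norm_num

lemma symMat_induction (h2 : (2 : F) ≠ 0) {P : symMat n F → Prop} (h0 : P 0)
    (hadd : ∀ x y, P x → P y → P (x + y)) (hsq : ∀ (c : F) v, P (c • sqMat v))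
    (x : symMat n F) : P x := by
  rw [symMat_eq_sum h2 x]
  refine Finset.sum_induction _ P hadd h0 fun i _ => Finset.sum_induction _ P hadd h0 fun j _ => ?_
  rw [symPair, smul_sub, smul_sub, sub_eq_add_neg, sub_eq_add_neg, ← neg_smul, ← neg_smul]
  exact hadd _ _ (hadd _ _ (hsq _ _) (hsq _ _)) (hsq _ _)

end Span

/-! ### From lines to affine maps -/

section Affine

variable {n : ℕ} {F : Type*} [Field F]

lemma sub_add_eq_of_lines (h2 : (2 : F) ≠ 0) {φ : symMat n F → symMat n F}
    (hinj : Function.Injective φ)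
    (hline : ∀ x v, ∃ B : symMat n F, IsSymmRankOne (B : Matrix (Fin n) (Fin n) F) ∧
      ∀ t : F, φ (x + t • sqMat v) = φ x + t • B)
    (x : symMat n F) (v w : Fin n → F) (t : F) :
    φ (x + t • sqMat w + sqMat v) - φ (x + t • sqMat w) = φ (x + sqMat v) - φ x := by
  choose B hB hφ using hline
  have hφ1 : ∀ x v, φ (x + sqMat v) = φ x + B x v := fun x v => by simpa using hφ x v 1
  set E := B (x + sqMat v) w - B x w with hE
  have hBt : ∀ t : F, B (x + t • sqMat w) v = B x v + t • E := by
    intro t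
    have h := hφ1 (x + t • sqMat w) v
    rw [add_right_comm, hφ, hφ, hφ1] at h
    rw [hE, smul_sub, ← sub_eq_iff_eq_add'.2 h]
    abel
  suffices hE0 : E = 0 by
    rw [hφ1, hφ1, hBt, hE0]; simp
  by_contra hE0
  have hE0' : (E : Matrix (Fin n) (Fin n) F) ≠ 0 := by simpa using hE0
  obtain ⟨b, hb⟩ : ∃ b : F, (B x v : Matrix (Fin n) (Fin n) F) = b • E := by
    refine exists_eq_smul_of_isSymmRankOne_add h2 (hB x v) ?_ ?_ hE0'
    · have := hB (x + (1 : F) • sqMat w) v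
      rw [hBt] at this; simpa using this
    · have := hB (x + (-1 : F) • sqMat w) v
      rw [hBt] at this; simpa [sub_eq_add_neg] using this
  have hb' : B x v = b • E := Subtype.ext hb
  have hcol : φ (x + (-b) • sqMat w + sqMat v) = φ (x + (-b) • sqMat w) := by
    -- The direction `B x v + t E = (b + t) E` vanishes at `t = -b`, against injectivity unless `v
    -- vᵗ = 0`.
    rw [hφ1, hBt, hb', ← add_smul, add_neg_cancel, zero_smul, add_zero]
  have hv : sqMat v = 0 := by simpa using hinj hcol
  exact hE0 (by rw [hE, hv]; simp)

lemma exists_linear_of_lines (h2 : (2 : F) ≠ 0) {φ : symMat n F → symMat n F}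
    (hinj : Function.Injective φ)
    (hline : ∀ x v, ∃ B : symMat n F, IsSymmRankOne (B : Matrix (Fin n) (Fin n) F) ∧
      ∀ t : F, φ (x + t • sqMat v) = φ x + t • B) :
    ∃ L : symMat n F →ₗ[F] symMat n F, (∀ x, φ x = φ 0 + L x) ∧
      ∀ v, IsSymmRankOne (L (sqMat v) : Matrix (Fin n) (Fin n) F) := by
  have hconst : ∀ v y x, φ (x + y + sqMat v) - φ (x + y) = φ (x + sqMat v) - φ x := by
    intro v y
    induction y using symMat_induction h2 with
    | h0 => simp
    | hadd y z hy hz =>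
      intro x
      rw [← add_assoc, hz, hy]
    | hsq c w => exact fun x => sub_add_eq_of_lines h2 hinj hline x v w c
  set l : symMat n F → symMat n F := fun x => φ x - φ 0 with hl
  have hstep : ∀ x v (t : F), φ (x + t • sqMat v) = φ x + t • l (sqMat v) := by
    intro x v t
    obtain ⟨B, -, hB⟩ := hline x v
    have h1 := hconst v x 0
    simp only [zero_add] at h1
    have h3 := hB 1
    rw [one_smul, one_smul] at h3
    rw [hB, hl]
    simp only
    rw [← h1, h3, add_sub_cancel_left]
  have hlin : ∀ y x, ∀ t : F, l (x + t • y) = l x + t • l y := by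
    intro y
    induction y using symMat_induction h2 with
    | h0 => simp [hl]
    | hadd y z hy hz =>
      intro x t
      have h1 := hz y 1
      rw [one_smul, one_smul] at h1
      rw [smul_add, ← add_assoc, hz, hy, h1, smul_add, add_assoc]
    | hsq c v =>
      intro x t
      have h0 := hstep 0 v c
      rw [zero_add] at h0
      have h1 : l (c • sqMat v) = c • l (sqMat v) := by
        simp only [hl] at h0 ⊢
        rw [h0]; abel
      rw [h1, smul_smul, smul_smul]
      have h3 := hstep x v (t * c)
      simp only [hl] at h3 ⊢
      rw [h3]; abel
  have hl0 : l 0 = 0 := by simp [hl]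
  refine ⟨⟨⟨l, fun x y => by simpa using hlin y x 1⟩, fun t x => by simpa [hl0] using hlin x 0 t⟩,
    fun x => by simp [hl], fun v => ?_⟩
  obtain ⟨B, hB, h⟩ := hline 0 v
  have : l (sqMat v) = B := by
    have := h 1
    simp only [one_smul, zero_add] at this
    simp [hl, this]
  simpa [this] using hB

end Affine

/-! ### Common linear part and opposite translations -/

section DetPreserver

variable {n : ℕ} {F : Type*} [Field F]

lemma eq_of_det_add_eq (h2 : (2 : F) ≠ 0) {x y : symMat n F}
    (h : ∀ z : symMat n F, ((x : Matrix (Fin n) (Fin n) F) + z).det =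
      ((y : Matrix (Fin n) (Fin n) F) + z).det) : x = y := by
  let S : Submodule F (Bool → F) :=
    { carrier := {f | f true = f false}
      add_mem' := by intro f g hf hg; simp_all
      zero_mem' := rfl
      smul_mem' := by intro c f hf; simp_all }
  let γ : Bool → Matrix (Fin n) (Fin n) F := fun b => if b then x else y
  ext i j
  exact entry_mem (S := S) (γ := γ) h2 rfl (by rintro (_ | _); exacts [y.2, x.2])
    (fun z hz => h ⟨z, hz⟩) i j

lemma exists_isSymmRankOne_line (h2 : (2 : F) ≠ 0) {φ ψ : symMat n F → symMat n F}
    (hψ : Function.Surjective ψ)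
    (hdet : ∀ x y : symMat n F, ((φ x : Matrix (Fin n) (Fin n) F) + ψ y).det =
      ((x : Matrix (Fin n) (Fin n) F) + y).det) (x : symMat n F) (v : Fin n → F) :
    ∃ B : symMat n F, IsSymmRankOne (B : Matrix (Fin n) (Fin n) F) ∧
      ∀ t : F, φ (x + t • sqMat v) = φ x + t • B := by
  obtain ⟨B, hB, h⟩ := exists_isSymmRankOne_direction h2
    (γ := fun t => (φ (x + t • sqMat v) : Matrix (Fin n) (Fin n) F)) (fun t => (φ _).2) (by
      intro z hz
      obtain ⟨y, hy⟩ := hψ ⟨z, hz⟩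
      convert det_add_smul_vecMulVec_mem ((x : Matrix (Fin n) (Fin n) F) + (y : Matrix (Fin n) (Fin n) F)) v v using 2 with t
      have := hdet (x + t • sqMat v) y
      rw [hy] at this
      rw [this]
      simp only [sqMat, Submodule.coe_add, Submodule.coe_smul]
      congr 1; abel)
  refine ⟨⟨B, hB.isSymm⟩, hB, fun t => Subtype.ext ?_⟩
  simpa using h t

/-- Evaluating at `t x` gives `tⁿ det (L x) = det (t x + k)`, a polynomial identity since `n < |F|`.
Leading coefficients give `det (L x) = det x`, so translation by `k` preserves `det`. -/
lemma eq_zero_of_det_linear (h2 : (2 : F) ≠ 0) (hcard : (n : Cardinal) < Cardinal.mk F)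
    {L : symMat n F →ₗ[F] symMat n F} {k : symMat n F}
    (h : ∀ x, (L x : Matrix (Fin n) (Fin n) F).det = ((x : Matrix (Fin n) (Fin n) F) + k).det) :
    k = 0 := by
  refine (eq_of_det_add_eq h2 fun x => ?_)
  open Polynomial in
  have hp : (det ((X : F[X]) • (x : Matrix (Fin n) (Fin n) F).map C +
      (k : Matrix (Fin n) (Fin n) F).map C) - C (L x : Matrix (Fin n) (Fin n) F).det * X ^ n) = 0 := by
    refine eq_zero_of_forall_eval_zero_of_natDegree_lt_card _ (fun t => ?_) (lt_of_le_of_lt ?_ hcard)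
    · have := h (t • x)
      rw [map_smul] at this
      simp only [Submodule.coe_smul, det_smul, Fintype.card_fin] at this
      have he : eval t (det ((X : F[X]) • (x : Matrix (Fin n) (Fin n) F).map C +
          (k : Matrix (Fin n) (Fin n) F).map C)) =
          (t • (x : Matrix (Fin n) (Fin n) F) + (k : Matrix (Fin n) (Fin n) F)).det := by
        rw [← coe_evalRingHom, RingHom.map_det]
        congr 1
        ext i j
        simp
        ring
      rw [eval_sub, he, ← this]
      simp only [eval_mul, eval_C, eval_pow, eval_X]
      ring
    · rw [Nat.cast_le]
      refine (natDegree_sub_le _ _).trans (max_le ?_ (natDegree_C_mul_X_pow_le _ _))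
      have hd := natDegree_det_X_add_C_le (x : Matrix (Fin n) (Fin n) F)
        (k : Matrix (Fin n) (Fin n) F)
      rwa [Fintype.card_fin] at hd
  have := congrArg (fun p => Polynomial.coeff p n) hp
  have hc := Polynomial.coeff_det_X_add_C_card (x : Matrix (Fin n) (Fin n) F) (k : Matrix (Fin n) (Fin n) F)
  rw [Fintype.card_fin] at hc
  simp only [Polynomial.coeff_sub, hc, Polynomial.coeff_C_mul_X_pow, Polynomial.coeff_zero] at this
  simp at this
  rw [add_comm, ← h, ← sub_eq_zero.1 this]
  simp

lemma exists_linear_translate (h2 : (2 : F) ≠ 0) (hcard : (n : Cardinal) < Cardinal.mk F)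
    {φ ψ : symMat n F → symMat n F} (hψ : Function.Surjective ψ)
    (hdet : ∀ x y : symMat n F, ((φ x : Matrix (Fin n) (Fin n) F) + ψ y).det =
      ((x : Matrix (Fin n) (Fin n) F) + y).det) :
    ∃ (x₀ : symMat n F) (L : symMat n F →ₗ[F] symMat n F),
      (∀ v, IsSymmRankOne (L (sqMat v) : Matrix (Fin n) (Fin n) F)) ∧
      (∀ x, (L x : Matrix (Fin n) (Fin n) F).det = (x : Matrix (Fin n) (Fin n) F).det) ∧
      (∀ x, φ x = L (x + x₀)) ∧ ∀ x, ψ x = L (x - x₀) := by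
  have hinj : Function.Injective φ := by
    intro x y hxy
    refine eq_of_det_add_eq h2 fun z => ?_
    rw [← hdet x, ← hdet y, hxy]
  obtain ⟨L, hL, hL1⟩ := exists_linear_of_lines h2 hinj (exists_isSymmRankOne_line h2 hψ hdet)
  have hLinj : Function.Injective L := by
    intro x y hxy
    apply hinj
    rw [hL x, hL y, hxy]
  have hLsurj := LinearMap.injective_iff_surjective.1 hLinj
  have hψL : ∀ y, ψ y = L y + ψ 0 := by
    intro y
    suffices h : ψ y - L y = ψ 0 by rw [← h]; abel
    refine eq_of_det_add_eq h2 fun z => ?_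
    obtain ⟨x, hx⟩ := hLsurj (z - φ 0)
    have e1 := hdet (x - y) y
    have e2 := hdet x 0
    rw [hL, map_sub, hx] at e1
    rw [hL, hx] at e2
    simp only [AddSubgroupClass.coe_sub, Submodule.coe_add, Submodule.coe_zero] at e1 e2 ⊢
    rw [sub_add_cancel] at e1
    rw [add_zero, ← e1] at e2
    convert e2.symm using 2 <;> abel
  obtain ⟨x₀, hx₀⟩ := hLsurj (φ 0)
  obtain ⟨y₀, hy₀⟩ := hLsurj (ψ 0)
  have hk : -(x₀ + y₀) = 0 := by
    refine eq_zero_of_det_linear h2 hcard (L := L) fun x => ?_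
    have := hdet (x - (x₀ + y₀)) 0
    rw [hL, ← hx₀, ← hy₀, ← Submodule.coe_add, ← map_add, ← map_add] at this
    rw [← Submodule.coe_add]
    convert this using 3
    · congr 1; abel
    · simp; abel
  have hy : y₀ = -x₀ := by
    rw [neg_eq_zero] at hk
    exact (neg_eq_of_add_eq_zero_right hk).symm
  refine ⟨x₀, L, hL1, fun x => ?_, fun x => ?_, fun x => ?_⟩
  · have := hdet x 0
    rw [hL, ← hx₀, ← hy₀, hy, ← Submodule.coe_add, map_neg, Submodule.coe_zero, add_zero] at this
    rw [← this]
    congr 2; abel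
  · rw [map_add, hx₀, hL, add_comm]
  · rw [hψL, ← hy₀, hy, sub_eq_add_neg, map_add]

end DetPreserver

/-! ### Linear maps sending squares to rank at most one -/

section RankOnePreserver

variable {n : ℕ} {F : Type*} [Field F]

open Polynomial in
lemma exists_sq_ne_one (h : (3 : Cardinal) < Cardinal.mk F) : ∃ t : F, t ≠ 0 ∧ t ^ 2 ≠ 1 := by
  have hdeg : (X ^ 3 - X : F[X]).natDegree = 3 := by compute_degree!
  obtain ⟨t, ht⟩ := exists_eval_ne_zero_of_natDegree_lt_card (X ^ 3 - X : F[X])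
    (by intro h0; simp [h0] at hdeg) (by rw [hdeg]; exact_mod_cast h)
  refine ⟨t, ?_, ?_⟩ <;> intro h0 <;> apply ht <;> simp only [eval_sub, eval_pow, eval_X]
  · simp [h0]
  · rw [pow_succ, h0]; ring

lemma eq_smul_single_add_single (h2 : (2 : F) ≠ 0) {M : Matrix (Fin n) (Fin n) F} (hM : M.IsSymm)
    {i j : Fin n} (hij : i ≠ j) {a b : F} (ha : a ≠ 0) (hb : b ≠ 0)
    {t : F} (ht : t ≠ 0) (ht1 : t ^ 2 ≠ 1)
    (h : ∀ s : F, IsSymmRankOne (Matrix.single i i a + s ^ 2 • Matrix.single j j b + s • M)) :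
    M = M i j • (Matrix.single i j 1 + Matrix.single j i 1) := by
  have hs := hM.apply
  have hcross : ∀ s : F, (a + s * M i i) * (s ^ 2 * b + s * M j j) = s * M i j * (s * M i j) := by
    intro s
    simpa [hij, hij.symm, hs i j] using (h s).minor_eq i i j j
  have hii : M i i = 0 := by
    have h0 : 2 * t * (t ^ 2 - 1) * b * M i i = 0 := by
      -- The odd part in `s` is `a s M j j + b s³ M i i`; a `t` with `t³ ≠ t` separates its terms.
      linear_combination hcross t - hcross (-t) - t * (hcross 1 - hcross (-1))
    simpa [h2, ht, sub_eq_zero, ht1, hb] using h0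
  have hjj : M j j = 0 := by
    have h0 : 2 * a * M j j = 0 := by
      linear_combination hcross 1 - hcross (-1) - 2 * b * hii
    simpa [h2, ha] using h0
  have hdiag : ∀ k, M k k = 0 := by
    intro k
    by_cases hki : k = i
    · rw [hki, hii]
    by_cases hkj : k = j
    · rw [hkj, hjj]
    have hk : ∀ s : F, a * (s * M k k) = s * M i k * (s * M i k) := by
      intro s
      simpa [hij, hij.symm, Ne.symm hki, Ne.symm hkj, hii, hs i k] using (h s).minor_eq i i k k
    have h0 : 2 * a * M k k = 0 := by linear_combination hk 1 - hk (-1)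
    simpa [h2, ha] using h0
  have hzero : ∀ k l, k ≠ i → k ≠ j → k ≠ l → M k l = 0 := by
    intro k l hki hkj hkl
    have := (h 1).minor_eq k k l l
    simpa [hdiag, hs k l, Ne.symm hki, Ne.symm hkj] using this
  ext k l
  by_cases hkl : k = l
  · subst hkl
    rw [hdiag]
    by_cases hki : k = i
    · subst hki; simp [hij.symm]
    · simp [Ne.symm hki]
  by_cases hk : k ≠ i ∧ k ≠ j
  · rw [hzero k l hk.1 hk.2 hkl]; simp [Ne.symm hk.1, Ne.symm hk.2]
  by_cases hl : l ≠ i ∧ l ≠ j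
  · rw [← hs, hzero l k hl.1 hl.2 (Ne.symm hkl)]; simp [Ne.symm hl.1, Ne.symm hl.2]
  rw [not_and_or, not_ne_iff, not_ne_iff] at hk hl
  rcases hk with rfl | rfl <;> rcases hl with rfl | rfl
  · exact absurd rfl hkl
  · simp [hij]
  · simp [hij.symm, hs]
  · exact absurd rfl hkl

lemma sqMat_single_add_smul_single (i j : Fin n) (s : F) :
    sqMat (Pi.single i 1 + s • Pi.single j 1) =
      sqMat (Pi.single i 1) + s ^ 2 • sqMat (Pi.single j 1) + s • symPair i j := by
  ext k l
  simp [sqMat, symPair, vecMulVec_apply]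
  ring

lemma exists_congr_of_diagonal (h2 : (2 : F) ≠ 0) (hcard : ((n ^ 2 + 1 : ℕ) : Cardinal) ≤ Cardinal.mk F)
    {L : symMat n F →ₗ[F] Matrix (Fin n) (Fin n) F}
    (hL : ∀ v, IsSymmRankOne (L (sqMat v)))
    {c : Fin n → F} (hc : ∀ i, c i ≠ 0)
    (hd : ∀ i, L (sqMat (Pi.single i 1)) = Matrix.single i i (c i)) :
    ∃ (β : F) (u : Matrix (Fin n) (Fin n) F), ∀ x, L x = β • (u * x * uᵀ) := by
  have hpair : ∀ i j, ∃ μ : F, L (symPair i j) = μ • (Matrix.single i j 1 + Matrix.single j i 1) := by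
    intro i j
    by_cases hij : i = j
    · subst hij
      refine ⟨c i, ?_⟩
      have h0 : (symPair i i : symMat n F) = (2 : F) • sqMat (Pi.single i 1) := by
        ext k l
        simp [symPair, sqMat, vecMulVec_apply]
        ring
      rw [h0, map_smul, hd, ← two_smul F (Matrix.single i i (1 : F)), smul_smul,
        Matrix.smul_single, Matrix.smul_single]
      simp [mul_comm]
    · have hn : 2 ≤ n := by
        have := i.2; have := j.2; have := Fin.val_ne_of_ne hij
        omega
      obtain ⟨t, ht, ht1⟩ := exists_sq_ne_one (F := F)
        (lt_of_lt_of_le (by exact_mod_cast (by nlinarith : 3 < n ^ 2 + 1)) hcard)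
      refine ⟨_, eq_smul_single_add_single h2 ?_ hij (hc i) (hc j) ht ht1 fun s => ?_⟩
      · rw [symPair, map_sub, map_sub]
        exact ((hL _).isSymm.sub (hL _).isSymm).sub (hL _).isSymm
      · have := hL (Pi.single i 1 + s • Pi.single j 1)
        rwa [sqMat_single_add_smul_single, map_add, map_add, map_smul, map_smul, hd, hd] at this
  choose μ hμ using hpair
  -- `1` is the all-ones vector: `L` multiplies entry `(k, l)` by a fixed scalar, read off here as
  -- `β g k g l`.
  obtain ⟨β, g, hg⟩ := hL 1
  have hentry : ∀ x k l, L x k l = (x : Matrix (Fin n) (Fin n) F) k l * ((μ k l + μ l k) / 2) := by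
    intro x k l
    have hs : (x : Matrix (Fin n) (Fin n) F) l k = (x : Matrix (Fin n) (Fin n) F) k l :=
      Matrix.IsSymm.apply x.2 k l
    conv_lhs => rw [symMat_eq_sum h2 x]
    simp [hμ, Matrix.sum_apply, Matrix.single_apply, Finset.sum_add_distrib, ite_and, hs]
    ring
  refine ⟨β, diagonal g, fun x => ?_⟩
  ext k l
  have h1 := hentry (sqMat 1) k l
  rw [hg] at h1
  simp [sqMat, vecMulVec_apply] at h1
  rw [hentry, ← h1]
  simp [Matrix.diagonal_mul, Matrix.mul_diagonal]
  ring

lemma exists_congr_of_det (h2 : (2 : F) ≠ 0) (hcard : ((n ^ 2 + 1 : ℕ) : Cardinal) ≤ Cardinal.mk F)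
    {L : symMat n F →ₗ[F] symMat n F}
    (hL : ∀ v, IsSymmRankOne (L (sqMat v) : Matrix (Fin n) (Fin n) F))
    (hdet : ∀ x, (L x : Matrix (Fin n) (Fin n) F).det = (x : Matrix (Fin n) (Fin n) F).det) :
    ∃ (β : F) (u : Matrix (Fin n) (Fin n) F), (β • u ^ 2).det = 1 ∧
      ∀ x, (L x : Matrix (Fin n) (Fin n) F) = β • (u * x * uᵀ) := by
  have hone : (1 : Matrix (Fin n) (Fin n) F) ∈ symMat n F := Matrix.isSymm_one
  choose c f hcf using fun i => hL (Pi.single i 1)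
  have hsum : (⟨1, hone⟩ : symMat n F) = ∑ i, sqMat (Pi.single i 1) := by
    ext k l
    simp [sqMat, Matrix.sum_apply, vecMulVec_apply, Matrix.one_apply, Pi.single_apply]
  set G : Matrix (Fin n) (Fin n) F := (of f)ᵀ with hG
  -- Since `det (L 1) = 1`, this makes `G` invertible and every `c i` nonzero; congruence by `G⁻¹`
  -- reduces to the diagonal case.
  have hLone : (L ⟨1, hone⟩ : Matrix (Fin n) (Fin n) F) = G * diagonal c * Gᵀ := by
    rw [hsum, map_sum]
    ext k l
    rw [Matrix.mul_apply]
    simp only [AddSubmonoidClass.coe_finsetSum, hcf, Matrix.sum_apply, Matrix.smul_apply,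
      vecMulVec_apply, hG, Matrix.mul_diagonal, transpose_apply, of_apply, smul_eq_mul]
    exact Finset.sum_congr rfl fun _ _ => by ring
  have hdet1 := hdet ⟨1, hone⟩
  rw [hLone] at hdet1
  simp only [det_mul, det_diagonal, det_transpose, det_one] at hdet1
  have hGu : IsUnit G.det := by
    rw [isUnit_iff_ne_zero]; intro h; simp [h] at hdet1
  have hc : ∀ i, c i ≠ 0 := by
    intro i hi
    rw [Finset.prod_eq_zero (Finset.mem_univ i) hi] at hdet1
    simp at hdet1
  let L' : symMat n F →ₗ[F] Matrix (Fin n) (Fin n) F :=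
    { toFun := fun x => G⁻¹ * L x * G⁻¹ᵀ
      map_add' := by intro x y; simp [Matrix.mul_add, Matrix.add_mul]
      map_smul' := by intro t x; simp }
  obtain ⟨β, u, hu⟩ := exists_congr_of_diagonal h2 hcard (L := L') (fun v => (hL v).congr G⁻¹) hc (by
    intro i
    have hGi : G⁻¹ *ᵥ f i = Pi.single i 1 := by
      have : f i = G *ᵥ Pi.single i 1 := by
        ext k; simp [hG]
      rw [this, mulVec_mulVec, nonsing_inv_mul _ hGu, one_mulVec]
    change G⁻¹ * (L (sqMat (Pi.single i 1)) : Matrix (Fin n) (Fin n) F) * G⁻¹ᵀ = _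
    rw [hcf]
    simp only [Matrix.mul_smul, Matrix.smul_mul, mul_vecMulVec, vecMulVec_mul, vecMul_transpose, hGi]
    rw [← Matrix.single_eq_single_vecMulVec_single]
    simp)
  have key : ∀ x, (L x : Matrix (Fin n) (Fin n) F) = β • (G * u * x * (G * u)ᵀ) := by
    intro x
    have h := congrArg (fun M => G * M * Gᵀ) (hu x)
    have hGt : IsUnit Gᵀ.det := by rwa [det_transpose]
    change G * (G⁻¹ * (L x : Matrix (Fin n) (Fin n) F) * G⁻¹ᵀ) * Gᵀ = _ at h
    rw [transpose_nonsing_inv] at h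
    rw [Matrix.mul_assoc, Matrix.mul_assoc (G⁻¹ * _), nonsing_inv_mul _ hGt, Matrix.mul_one,
      ← Matrix.mul_assoc, mul_nonsing_inv _ hGu, Matrix.one_mul] at h
    rw [h]
    simp [Matrix.mul_assoc]
  refine ⟨β, G * u, ?_, key⟩
  have := hdet ⟨1, hone⟩
  rw [key] at this
  rw [Matrix.mul_one, det_smul, det_mul, det_transpose] at this
  rw [det_smul, sq, det_mul, this, det_one]

end RankOnePreserver

theorem theorem1p1 {F : Type*} [Field F] (n : ℕ)
    (hchar : ringChar F ≠ 2)
    (hcard : ((n ^ 2 + 1 : ℕ) : Cardinal) ≤ Cardinal.mk F)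
    (φ ψ : symMat n F → symMat n F)
    (hsurj : Function.Surjective φ ∨ Function.Surjective ψ)
    (hdet : ∀ x y : symMat n F,
      ((φ x : Matrix (Fin n) (Fin n) F) + (ψ y : Matrix (Fin n) (Fin n) F)).det =
        ((x : Matrix (Fin n) (Fin n) F) + (y : Matrix (Fin n) (Fin n) F)).det) :
    ∃ (x₀ : symMat n F) (u : Matrix (Fin n) (Fin n) F) (β : F),
      (β • u ^ 2).det = 1 ∧
      (∀ x : symMat n F, (φ x : Matrix (Fin n) (Fin n) F) =
        β • (u * ((x : Matrix (Fin n) (Fin n) F) + (x₀ : Matrix (Fin n) (Fin n) F)) *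
          u.transpose)) ∧
      (∀ x : symMat n F, (ψ x : Matrix (Fin n) (Fin n) F) =
        β • (u * ((x : Matrix (Fin n) (Fin n) F) - (x₀ : Matrix (Fin n) (Fin n) F)) *
          u.transpose)) := by
  have h2 : (2 : F) ≠ 0 := Ring.two_ne_zero hchar
  have hcard' : (n : Cardinal) < Cardinal.mk F :=
    lt_of_lt_of_le (by exact_mod_cast (by nlinarith : n < n ^ 2 + 1)) hcard
  rcases hsurj with hφ | hψ
  · obtain ⟨x₀, L, hL, hLdet, h1, h3⟩ := exists_linear_translate h2 hcard' (φ := ψ) hφ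
      fun x y => by rw [add_comm, hdet, add_comm]
    obtain ⟨β, u, hu, h⟩ := exists_congr_of_det h2 hcard hL hLdet
    refine ⟨-x₀, u, β, hu, fun x => ?_, fun x => ?_⟩
    · rw [h3, h]; simp [sub_eq_add_neg]
    · rw [h1, h]; simp
  · obtain ⟨x₀, L, hL, hLdet, h1, h3⟩ := exists_linear_translate h2 hcard' hψ hdet
    obtain ⟨β, u, hu, h⟩ := exists_congr_of_det h2 hcard hL hLdet
    refine ⟨x₀, u, β, hu, fun x => ?_, fun x => ?_⟩
    · rw [h1, h]; simp
    · rw [h3, h]; simp
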